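/- **Setting (biased linear bandit).** An action set $\mathcal{A}$ in $\mathbb{R}^{d+1}$ is a finite set of vectors $a_x=\binom{x}{z_x}$, $x\in\mathcal{X}\subset\mathbb{R}^d$, $z_x\in\{-1,+1\}$, with distinct covariates $x$, both groups $\{z_x=1\}$ and $\{z_x=-1\}$ nonempty, and $\{a_x\}$ spanning $\mathbb{R}^{d+1}$. For a parameter $\theta=\binom{\gamma}{\omega}$, $\gamma\in\mathbb{R}^d$, $\omega\in\mathbb{R}$, at each round $t$ a (possibly randomized) algorithm chooses an action $x_t$ on the basis of the past actions and observations, and then observes $y_t=x_t^\top\gamma+z_{x_t}\omega+\xi_t$ with $\xi_t$ i.i.d. $\mathcal{N}(0,1)$. Write $\Delta(\gamma)_x=\max_{x'\in\mathcal{X}}(x'-x)^\top\gamma$; the regret is $R_T^\theta=\mathbb{E}_\theta\big[\sum_{t\le T}\Delta(\gamma)_{x_t}\big]$. For $\mu:\mathcal{X}\to[0,\infty)$ let $V(\mu)=\sum_x\mu(x)a_xa_x^\top$, and for $\Delta\in[0,\infty)^{\mathcal{X}}$ let $$\kappa(\Delta)=\inf\Big\{\sum_{x}\mu(x)\Delta_x:\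 \mu:\mathcal{X}\to[0,\infty),\ e_{d+1}\in\operatorname{Im}V(\mu),\ e_{d+1}^\top V(\mu)^+e_{d+1}\le 1\Big\},$$ where $M^+$ is a generalized inverse of $M$ (a matrix with $MM^+M=M$) and $e_{d+1}$ is the last vector of the canonical basis of $\mathbb{R}^{d+1}$. Let $\mathbf{\Theta}^{\mathcal{A}}_{\Delta_{\min},\Delta_{\neq},\kappa}$ be the set of all $\theta=\binom{\gamma}{\omega}$ such that $|x^\top\gamma|\le 1$ for all $x\in\mathcal{X}$; the maximizer $x^*$ of $x\mapsto x^\top\gamma$ over $\mathcal{X}$ is unique; $(x^*-x')^\top\gamma\ge\Delta_{\min}$ for all $x'\ne x^*$ in $\mathcal{X}$; $(x^*-x')^\top\gamma\ge\Delta_{\neq}$ for all $x'\in\mathcal{X}$ with $z_{x'}\ne z_{x^*}$; and $\kappa(\Delta(\gamma))\le\kappa$. **Theorem.** For all real $\kappa\ge 2$ and all integers $d\ge 4$ there exists an action set $\mathcal{A}$ in $\mathbb{R}^{d+1}$ such that for all $(\Delta_{\min},\Delta_{\neq})\in(0,\tfrac18)^2$ with $\Delta_{\min}\le\Delta_{\neq}$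 and for every algorithm (which may depend on the horizon $T$), $$\liminf_{T\to\infty}\ \sup_{\theta\in\mathbf{\Theta}^{\mathcal{A}}_{\Delta_{\min},\Delta_{\neq},\kappa}}\frac{R_T^\theta}{\log T}\ \ge\ \frac{d}{10\,\Delta_{\min}}\ \vee\ \frac{\kappa+2}{8\,\Delta_{\neq}^2}.$$ -/

import Mathlib

open MeasureTheory ProbabilityTheory Filter Matrix

noncomputable section

/-! ### Generalized inverses -/

theorem exists_genInv {n : ℕ} (M : Matrix (Fin n) (Fin n) ℝ) :
    ∃ G : Matrix (Fin n) (Fin n) ℝ, M * G * M = M := by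
  obtain ⟨g, hg⟩ :=
    (M.toLin').rangeRestrict.exists_rightInverse_of_surjective (LinearMap.range_rangeRestrict _)
  obtain ⟨g', hg'⟩ := LinearMap.exists_extend g
  refine ⟨LinearMap.toMatrix' g', ?_⟩
  apply Matrix.toLin'.injective
  rw [Matrix.toLin'_mul, Matrix.toLin'_mul, Matrix.toLin'_toMatrix']
  ext1 i
  ext1
  have h1 : g' ((M.toLin') (Pi.single i 1)) = g ((M.toLin').rangeRestrict (Pi.single i 1)) :=
    LinearMap.congr_fun hg' ((M.toLin').rangeRestrict (Pi.single i 1))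
  have h2 : (M.toLin').rangeRestrict (g ((M.toLin').rangeRestrict (Pi.single i 1))) =
      (M.toLin').rangeRestrict (Pi.single i 1) :=
    LinearMap.congr_fun hg ((M.toLin').rangeRestrict (Pi.single i 1))
  have h3 := congrArg Subtype.val h2
  simp only [LinearMap.coe_comp, Function.comp_apply, LinearMap.coe_single]
  rw [h1]
  exact h3

/-- A generalized inverse of `M`, i.e. a matrix `G` with `M * G * M = M`. -/
def genInv {n : ℕ} (M : Matrix (Fin n) (Fin n) ℝ) : Matrix (Fin n) (Fin n) ℝ :=
  Classical.choose (exists_genInv M)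

theorem genInv_spec {n : ℕ} (M : Matrix (Fin n) (Fin n) ℝ) : M * genInv M * M = M :=
  Classical.choose_spec (exists_genInv M)

/-! ### Action sets -/

/-- A finite set of actions of the biased linear bandit in dimension `d`, enumerated by `Fin k`:
distinct covariates `x i`, groups `z i ∈ {-1, 1}`, both groups nonempty, and the vectors
`(x i, z i)` span `ℝ^(d+1)`. -/
structure ActionSet (d : ℕ) where
  k : ℕ
  x : Fin k → (Fin d → ℝ)
  z : Fin k → ℝ
  z_mem : ∀ i, z i = 1 ∨ z i = -1
  x_injective : Function.Injective x
  exists_pos : ∃ i, z i = 1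
  exists_neg : ∃ i, z i = -1
  span_eq_top :
    Submodule.span ℝ (Set.range fun i => (Fin.snoc (x i) (z i) : Fin (d + 1) → ℝ)) = ⊤

namespace ActionSet

variable {d : ℕ} (A : ActionSet d)

/-- The vector `a_x = (x, z_x)` of `ℝ^(d+1)` that describes an action. -/
def vec (i : Fin A.k) : Fin (d + 1) → ℝ := Fin.snoc (A.x i) (A.z i)

/-- The covariance matrix `V(μ) = ∑ μ(x) a_x a_xᵀ` of an allocation `μ`. -/
def V (μ : Fin A.k → ℝ) : Matrix (Fin (d + 1)) (Fin (d + 1)) ℝ :=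
  ∑ i, μ i • vecMulVec (A.vec i) (A.vec i)

/-- The gap `Δ(γ)_x = max_{x'} (x' - x)ᵀ γ`. -/
def gap (γ : Fin d → ℝ) (i : Fin A.k) : ℝ := ⨆ j, (A.x j - A.x i) ⬝ᵥ γ

/-- The last vector `e_{d+1}` of the canonical basis of `ℝ^(d+1)`. -/
def eLast (d : ℕ) : Fin (d + 1) → ℝ := Pi.single (Fin.last d) 1

/-- Allocations `μ ≥ 0` with `e_{d+1} ∈ Im V(μ)` that estimate the bias with variance
`e_{d+1}ᵀ V(μ)⁺ e_{d+1}` at most `1`. -/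
def biasDesigns : Set (Fin A.k → ℝ) :=
  {μ | (∀ i, 0 ≤ μ i) ∧ (∃ u, A.V μ *ᵥ u = eLast d) ∧
    eLast d ⬝ᵥ (genInv (A.V μ) *ᵥ eLast d) ≤ 1}

/-- The minimal regret `κ(Δ) = inf ∑ μ(x) Δ_x` over the allocations `μ` that estimate the bias
with variance at most `1`. -/
def kappa (Δ : Fin A.k → ℝ) : EReal :=
  ⨅ μ ∈ A.biasDesigns, ((∑ i, μ i * Δ i : ℝ) : EReal)

/-- The admissible regression parameters: all rewards are at most `1` in absolute value. -/
def admissible : Set (Fin d → ℝ) := {γ | ∀ i, |A.x i ⬝ᵥ γ| ≤ 1}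

/-- The actions of maximal reward. -/
def best (γ : Fin d → ℝ) : Set (Fin A.k) := {i | ∀ j, A.x j ⬝ᵥ γ ≤ A.x i ⬝ᵥ γ}

/-- The parameters `θ = (γ, ω)` with minimum gap at least `Δmin` and between-group gap at
least `Δneq`. -/
def params (Δmin Δneq : ℝ) : Set ((Fin d → ℝ) × ℝ) :=
  {θ | θ.1 ∈ A.admissible ∧ (∃! i, i ∈ A.best θ.1) ∧
    ∀ i ∈ A.best θ.1, ∀ j,
      (j ≠ i → Δmin ≤ (A.x i - A.x j) ⬝ᵥ θ.1) ∧
      (A.z j ≠ A.z i → Δneq ≤ (A.x i - A.x j) ⬝ᵥ θ.1)}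

/-- The parameters of `params` for which moreover `κ(Δ(γ)) ≤ κ`. -/
def paramsKappa (Δmin Δneq κ : ℝ) : Set ((Fin d → ℝ) × ℝ) :=
  A.params Δmin Δneq ∩ {θ | A.kappa (A.gap θ.1) ≤ (κ : EReal)}

/-- The law `N(xᵀ γ + z_x ω, 1)` of the biased evaluation received after an action is chosen. -/
def evalKernel (θ : (Fin d → ℝ) × ℝ) : Kernel (Fin A.k) ℝ :=
  Kernel.ofFunOfCountable fun i => gaussianReal (A.x i ⬝ᵥ θ.1 + A.z i * θ.2) 1

instance (θ : (Fin d → ℝ) × ℝ) : IsMarkovKernel (A.evalKernel θ) :=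
  ⟨fun i => inferInstanceAs
    (IsProbabilityMeasure (gaussianReal (A.x i ⬝ᵥ θ.1 + A.z i * θ.2) 1))⟩

end ActionSet

/-! ### Algorithms and regret -/

/-- A (possibly randomized) bandit algorithm on `k` actions: the conditional law of the next action
given the `t` past actions and the `t` evaluations observed after them. -/
structure BanditAlg (k : ℕ) where
  next : (t : ℕ) → Kernel (Fin t → Fin k × ℝ) (Fin k)
  markov : ∀ t, IsMarkovKernel (next t)

instance {k : ℕ} (alg : BanditAlg k) (t : ℕ) : IsMarkovKernel (alg.next t) := alg.markov t

namespace ActionSet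

variable {d : ℕ} (A : ActionSet d)

/-- The law of the first `t` rounds (action, evaluation) when `alg` plays against the parameter
`θ`. -/
def historyLaw (alg : BanditAlg A.k) (θ : (Fin d → ℝ) × ℝ) :
    (t : ℕ) → Measure (Fin t → Fin A.k × ℝ)
  | 0 => Measure.dirac Fin.elim0
  | t + 1 =>
    (historyLaw alg θ t ⊗ₘ (alg.next t ⊗ₖ Kernel.prodMkLeft _ (A.evalKernel θ))).map
      fun p => (Fin.snoc p.1 p.2 : Fin (t + 1) → Fin A.k × ℝ)

theorem measurable_snoc {X : Type*} [MeasurableSpace X] (t : ℕ) :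
    Measurable fun p : (Fin t → X) × X => (Fin.snoc p.1 p.2 : Fin (t + 1) → X) := by
  refine measurable_pi_iff.2 fun i => ?_
  refine Fin.lastCases ?_ (fun j => ?_) i
  · simpa using measurable_snd
  · simpa [Function.comp_def] using (measurable_pi_apply j).comp measurable_fst

instance (alg : BanditAlg A.k) (θ : (Fin d → ℝ) × ℝ) (t : ℕ) :
    IsProbabilityMeasure (A.historyLaw alg θ t) := by
  induction t with
  | zero => exact inferInstanceAs (IsProbabilityMeasure (Measure.dirac _))
  | succ t ih => exact Measure.isProbabilityMeasure_map (measurable_snoc t).aemeasurable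

/-- The regret `R_T^θ = E[∑_{t ≤ T} (x^* - x_t)ᵀ γ]`. -/
def regret (alg : BanditAlg A.k) (θ : (Fin d → ℝ) × ℝ) (T : ℕ) : ℝ :=
  ∫ h, ∑ t, A.gap θ.1 (h t).1 ∂(A.historyLaw alg θ T)

end ActionSet

end

/-! The proof is a change-of-measure argument on one explicit action set. For two parameters under
which no action has both gaps small, regret of order `log T` under both forces the divergence of the
two history laws to be at least `2 / 3 * log T` once `T` is large (`expSum_add_expSum_ge`,
`ActionSet.expSum_actionDiv_ge`). This divergence is the expected sum, over the actions played, of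
one-round Gaussian divergences (`integral_logLik`), so comparing the one-round divergence with the
gap action by action converts it into a lower bound on the regret. The threshold on `T` depends only
on the constants and not on the algorithm, hence tuning to the horizon does not help.

The action set, with `s = √κ`, consists of the canonical basis and the vector `-(1/s) e₀ - (1 - 1/s)
e₁`; only `e₁` is in group `-1`. Two families of alternatives give the two terms of the maximum. In
`exists_regret_ge_of_bias` the best action moves from `e₀` to `e₁` while a shift of the bias hides
the change on every basis action: only the last action tells the parameters apart, its mean moves by
just `2 * Δneq / s`, and each play of it costs at least `7 / 8`. In `exists_regret_ge_of_arms` the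
bias is fixed and each of the `d - 2` actions other than `e₀`, `e₁` becomes optimal in turn, a
change seen only by playing that action. An explicit design in `kappa_hardAction_le` shows that all
these parameters satisfy the constraint on `κ`. -/

noncomputable section

/-! ### Change of measure between two parameters. -/

namespace ActionSet

variable {d : ℕ} (A : ActionSet d)

/-- The mean of the evaluation of an action. -/
def mean (θ : (Fin d → ℝ) × ℝ) (i : Fin A.k) : ℝ := A.x i ⬝ᵥ θ.1 + A.z i * θ.2

/-- The log-likelihood ratio of one round between the parameters `θ'` and `θ`. -/
def logRatio (θ θ' : (Fin d → ℝ) × ℝ) (p : Fin A.k × ℝ) : ℝ :=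
  (A.mean θ' p.1 - A.mean θ p.1) * (p.2 - A.mean θ p.1)
    - (A.mean θ' p.1 - A.mean θ p.1) ^ 2 / 2

theorem measurable_of_section {k : ℕ} {E : Type*} [MeasurableSpace E] {f : Fin k × ℝ → E}
    (hf : ∀ i, Measurable fun y => f (i, y)) : Measurable f :=
  measurable_from_prod_countable_right hf

theorem measurable_logRatio (θ θ' : (Fin d → ℝ) × ℝ) : Measurable (A.logRatio θ θ') :=
  measurable_of_section fun i => by unfold logRatio; fun_prop

theorem lintegral_gaussian_change (m m' : ℝ) {f : ℝ → ENNReal} (hf : Measurable f) :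
    ∫⁻ y, f y ∂(gaussianReal m' 1) =
      ∫⁻ y, f y * ENNReal.ofReal (Real.exp ((m' - m) * (y - m) - (m' - m) ^ 2 / 2))
        ∂(gaussianReal m 1) := by
  rw [gaussianReal_of_var_ne_zero m' one_ne_zero, gaussianReal_of_var_ne_zero m one_ne_zero,
    lintegral_withDensity_eq_lintegral_mul _ (measurable_gaussianPDF _ _) hf,
    lintegral_withDensity_eq_lintegral_mul _ (measurable_gaussianPDF _ _) (by fun_prop)]
  refine lintegral_congr fun y => ?_
  simp only [Pi.mul_apply, gaussianPDF]
  rw [mul_left_comm, mul_comm, ← ENNReal.ofReal_mul (gaussianPDFReal_nonneg _ _ _)]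
  congr 2
  simp only [gaussianPDFReal]
  rw [mul_assoc (√_)⁻¹, ← Real.exp_add]
  congr 2
  simp only [NNReal.coe_one]
  ring

theorem lintegral_historyLaw_succ (alg : BanditAlg A.k) (θ : (Fin d → ℝ) × ℝ) (t : ℕ)
    {f : (Fin (t + 1) → Fin A.k × ℝ) → ENNReal} (hf : Measurable f) :
    ∫⁻ h, f h ∂(A.historyLaw alg θ (t + 1)) =
      ∫⁻ h, ∫⁻ i, ∫⁻ y, f (Fin.snoc (α := fun _ => Fin A.k × ℝ) h (i, y))
        ∂(gaussianReal (A.mean θ i) 1) ∂(alg.next t h) ∂(A.historyLaw alg θ t) := by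
  have hs := measurable_snoc (X := Fin A.k × ℝ) t
  rw [historyLaw, lintegral_map hf hs,
    Measure.lintegral_compProd (f := fun p => f (Fin.snoc p.1 p.2)) (hf.comp hs)]
  refine lintegral_congr fun h => ?_
  exact Kernel.lintegral_compProd _ _ _ ((hf.comp hs).comp measurable_prodMk_left)

/-- The cumulated log-likelihood ratio of a history. -/
def logLik (θ θ' : (Fin d → ℝ) × ℝ) {t : ℕ} (h : Fin t → Fin A.k × ℝ) : ℝ :=
  ∑ s, A.logRatio θ θ' (h s)

theorem measurable_logLik (θ θ' : (Fin d → ℝ) × ℝ) (t : ℕ) :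
    Measurable (A.logLik θ θ' (t := t)) :=
  Finset.measurable_sum _ fun s _ => (A.measurable_logRatio θ θ').comp (measurable_pi_apply s)

theorem logLik_snoc (θ θ' : (Fin d → ℝ) × ℝ) {t : ℕ} (h : Fin t → Fin A.k × ℝ)
    (p : Fin A.k × ℝ) :
    A.logLik θ θ' (Fin.snoc (α := fun _ => Fin A.k × ℝ) h p) =
      A.logLik θ θ' h + A.logRatio θ θ' p := by
  simp [logLik, Fin.sum_univ_castSucc]

/-- The algorithm draws its actions from the same kernels under both parameters, so these cancel and
only the Gaussian factors of the evaluations remain, one per round. -/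
theorem lintegral_historyLaw_change (alg : BanditAlg A.k) (θ θ' : (Fin d → ℝ) × ℝ) (t : ℕ)
    {f : (Fin t → Fin A.k × ℝ) → ENNReal} (hf : Measurable f) :
    ∫⁻ h, f h ∂(A.historyLaw alg θ' t) =
      ∫⁻ h, f h * ENNReal.ofReal (Real.exp (A.logLik θ θ' h)) ∂(A.historyLaw alg θ t) := by
  induction t with
  | zero => simp [historyLaw, logLik]
  | succ t ih =>
    have hs := measurable_snoc (X := Fin A.k × ℝ) t
    have hm := A.measurable_logLik θ θ' (t + 1)
    have hm' := A.measurable_logLik θ θ' t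
    rw [lintegral_historyLaw_succ _ _ _ _ hf, lintegral_historyLaw_succ _ _ _ _ (by fun_prop), ih]
    · refine lintegral_congr fun h => ?_
      rw [← lintegral_mul_const' _ _ ENNReal.ofReal_ne_top]
      refine lintegral_congr fun i => ?_
      have hsi : Measurable fun y : ℝ =>
          (Fin.snoc (α := fun _ => Fin A.k × ℝ) h (i, y) : Fin (t + 1) → Fin A.k × ℝ) :=
        hs.comp (measurable_prodMk_left.comp measurable_prodMk_left)
      rw [lintegral_gaussian_change (A.mean θ i) _
          (f := fun y => f (Fin.snoc (α := fun _ => Fin A.k × ℝ) h (i, y))) (hf.comp hsi),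
        ← lintegral_mul_const' _ _ ENNReal.ofReal_ne_top]
      refine lintegral_congr fun y => ?_
      rw [logLik_snoc, mul_assoc, ← ENNReal.ofReal_mul (Real.exp_nonneg _), ← Real.exp_add,
        add_comm (A.logLik θ θ' h)]
      rfl
    · have : (fun h : Fin t → Fin A.k × ℝ => ∫⁻ i, ∫⁻ y,
          f (Fin.snoc (α := fun _ => Fin A.k × ℝ) h (i, y)) ∂(gaussianReal (A.mean θ' i) 1)
            ∂(alg.next t h)) =
          fun h => ∫⁻ p, f (Fin.snoc (α := fun _ => Fin A.k × ℝ) h p)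
            ∂((alg.next t ⊗ₖ Kernel.prodMkLeft _ (A.evalKernel θ')) h) := by
        funext h
        exact (Kernel.lintegral_compProd (alg.next t) (Kernel.prodMkLeft _ (A.evalKernel θ')) h
          ((hf.comp hs).comp measurable_prodMk_left)).symm
      rw [this]
      exact Measurable.lintegral_kernel_prod_right' (hf.comp hs)

theorem historyLaw_eq_withDensity (alg : BanditAlg A.k) (θ θ' : (Fin d → ℝ) × ℝ) (t : ℕ) :
    A.historyLaw alg θ' t = (A.historyLaw alg θ t).withDensity
      fun h => ENNReal.ofReal (Real.exp (A.logLik θ θ' h)) := by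
  have hm := A.measurable_logLik θ θ' t
  refine Measure.ext_of_lintegral _ fun f hf => ?_
  rw [lintegral_historyLaw_change A alg θ θ' t hf,
    lintegral_withDensity_eq_lintegral_mul _ (by fun_prop) hf]
  exact lintegral_congr fun h => mul_comm _ _

theorem integrable_exp_logLik (alg : BanditAlg A.k) (θ θ' : (Fin d → ℝ) × ℝ) (t : ℕ) :
    Integrable (fun h => Real.exp (A.logLik θ θ' h)) (A.historyLaw alg θ t) ∧
      ∫ h, Real.exp (A.logLik θ θ' h) ∂(A.historyLaw alg θ t) = 1 := by
  have hm := A.measurable_logLik θ θ' t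
  have h1 : ∫⁻ h, ENNReal.ofReal (Real.exp (A.logLik θ θ' h)) ∂(A.historyLaw alg θ t) = 1 := by
    simpa using (lintegral_historyLaw_change A alg θ θ' t (f := fun _ => 1)
      measurable_const).symm
  constructor
  · exact (lintegral_ofReal_ne_top_iff_integrable (by fun_prop)
      (.of_forall fun h => Real.exp_nonneg _)).1 (by simp [h1])
  · rw [integral_eq_lintegral_of_nonneg_ae (.of_forall fun h => Real.exp_nonneg _) (by fun_prop),
      h1, ENNReal.toReal_one]

theorem integral_historyLaw_change (alg : BanditAlg A.k) (θ θ' : (Fin d → ℝ) × ℝ) (t : ℕ)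
    (f : (Fin t → Fin A.k × ℝ) → ℝ) :
    ∫ h, f h ∂(A.historyLaw alg θ' t) =
      ∫ h, Real.exp (A.logLik θ θ' h) * f h ∂(A.historyLaw alg θ t) := by
  have hm := A.measurable_logLik θ θ' t
  rw [historyLaw_eq_withDensity A alg θ θ' t,
    integral_withDensity_eq_integral_toReal_smul (by fun_prop)
      (.of_forall fun h => ENNReal.ofReal_lt_top)]
  refine integral_congr_ae (.of_forall fun h => ?_)
  simp [ENNReal.toReal_ofReal (Real.exp_nonneg _)]

/-- The sum is a martingale: given the past and the chosen action, the centered evaluation has mean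
zero. Finiteness of the action set gives a bound on the conditional absolute moment that is uniform
in the history, hence integrability. -/
theorem integral_centered (alg : BanditAlg A.k) (θ : (Fin d → ℝ) × ℝ) (c : Fin A.k → ℝ) (t : ℕ) :
    Integrable (fun h => ∑ s, c (h s).1 * ((h s).2 - A.mean θ (h s).1)) (A.historyLaw alg θ t) ∧
      ∫ h, ∑ s, c (h s).1 * ((h s).2 - A.mean θ (h s).1) ∂(A.historyLaw alg θ t) = 0 := by
  induction t with
  | zero => simp
  | succ t ih =>
    obtain ⟨ih1, ih2⟩ := ih
    have hs := measurable_snoc (X := Fin A.k × ℝ) t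
    set F : (Fin t → Fin A.k × ℝ) → ℝ :=
      fun h => ∑ s, c (h s).1 * ((h s).2 - A.mean θ (h s).1) with hF
    set g : Fin A.k × ℝ → ℝ := fun p => c p.1 * (p.2 - A.mean θ p.1) with hg
    have hgm : Measurable g := measurable_of_section fun i => by simp only [hg]; fun_prop
    have hgi (i : Fin A.k) : Integrable (fun y => g (i, y)) (gaussianReal (A.mean θ i) 1) := by
      have h1 : Integrable (fun y : ℝ => y) (gaussianReal (A.mean θ i) 1) :=
        (memLp_id_gaussianReal (μ := A.mean θ i) (v := 1) 1).integrable (by simp)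
      exact (h1.sub (integrable_const (A.mean θ i))).const_mul (c i)
    have hg0 (i : Fin A.k) : ∫ y, g (i, y) ∂(gaussianReal (A.mean θ i) 1) = 0 := by
      have h1 : Integrable (fun y : ℝ => y) (gaussianReal (A.mean θ i) 1) :=
        (memLp_id_gaussianReal (μ := A.mean θ i) (v := 1) 1).integrable (by simp)
      simp only [hg]
      rw [integral_const_mul, integral_sub h1 (integrable_const _), integral_id_gaussianReal]
      simp
    set K := alg.next t ⊗ₖ Kernel.prodMkLeft _ (A.evalKernel θ) with hK
    set μ := A.historyLaw alg θ t with hμ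
    have hgK (h : Fin t → Fin A.k × ℝ) : Integrable g (K h) := by
      rw [hK, integrable_compProd_iff hgm.aestronglyMeasurable]
      exact ⟨.of_forall fun i => hgi i, Integrable.of_finite⟩
    have hgK0 (h : Fin t → Fin A.k × ℝ) : ∫ p, g p ∂(K h) = 0 := by
      rw [hK, integral_compProd (hgK h)]
      exact (integral_congr_ae (.of_forall hg0)).trans (integral_zero _ _)
    have hgn (h : Fin t → Fin A.k × ℝ) : ∫ p, ‖g p‖ ∂(K h) ≤
        ∑ i, ∫ y, ‖g (i, y)‖ ∂(gaussianReal (A.mean θ i) 1) := by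
      rw [hK, integral_compProd (hgK h).norm]
      calc ∫ i, ∫ y, ‖g (i, y)‖ ∂(gaussianReal (A.mean θ i) 1) ∂(alg.next t h)
          ≤ ∫ i, (∑ i, ∫ y, ‖g (i, y)‖ ∂(gaussianReal (A.mean θ i) 1)) ∂(alg.next t h) := by
            refine integral_mono Integrable.of_finite (integrable_const _) fun i => ?_
            exact Finset.single_le_sum
              (f := fun i => ∫ y, ‖g (i, y)‖ ∂(gaussianReal (A.mean θ i) 1))
              (fun j _ => integral_nonneg fun y => norm_nonneg _) (Finset.mem_univ i)
        _ = _ := by simp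
    have hg2 : Integrable (fun p : (Fin t → Fin A.k × ℝ) × (Fin A.k × ℝ) => g p.2) (μ ⊗ₘ K) := by
      rw [Measure.integrable_compProd_iff
        (f := fun p => g p.2) (hgm.comp measurable_snd).aestronglyMeasurable]
      refine ⟨.of_forall hgK, ?_⟩
      refine Integrable.of_bound (C := ∑ i, ∫ y, ‖g (i, y)‖ ∂(gaussianReal (A.mean θ i) 1)) ?_
        (.of_forall fun h => ?_)
      · exact (hgm.norm.comp measurable_snd).stronglyMeasurable.integral_kernel_prod_right'
          |>.aestronglyMeasurable
      · rw [Real.norm_of_nonneg (integral_nonneg fun p => norm_nonneg _)]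
        exact hgn h
    have hF2 : Integrable (fun p : (Fin t → Fin A.k × ℝ) × (Fin A.k × ℝ) => F p.1) (μ ⊗ₘ K) := by
      have : Integrable F (μ ⊗ₘ K).fst := by rwa [Measure.fst_compProd]
      exact this.comp_measurable measurable_fst
    have hFm : Measurable fun h : Fin (t + 1) → Fin A.k × ℝ =>
        ∑ s, g (h s) :=
      Finset.measurable_sum _ fun s _ => hgm.comp (measurable_pi_apply s)
    have hcomp (p : (Fin t → Fin A.k × ℝ) × (Fin A.k × ℝ)) :
        ∑ s, g ((Fin.snoc (α := fun _ => Fin A.k × ℝ) p.1 p.2 : Fin (t + 1) → Fin A.k × ℝ) s) =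
          F p.1 + g p.2 := by
      simp [hF, hg, Fin.sum_univ_castSucc]
    change Integrable (fun h : Fin (t + 1) → Fin A.k × ℝ => ∑ s, g (h s)) _ ∧
      ∫ h : Fin (t + 1) → Fin A.k × ℝ, ∑ s, g (h s) ∂_ = 0
    rw [historyLaw, integrable_map_measure hFm.aestronglyMeasurable hs.aemeasurable,
      integral_map hs.aemeasurable hFm.aestronglyMeasurable]
    simp only [Function.comp_def, hcomp]
    refine ⟨hF2.add hg2, ?_⟩
    · rw [integral_add hF2 hg2, Measure.integral_compProd hF2, Measure.integral_compProd hg2]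
      simp [hgK0, ih2]

/-! ### Divergence of history laws and the two-point inequality. -/

/-- The expectation of the sum of `f` over the actions of the first `T` rounds. -/
def expSum (alg : BanditAlg A.k) (θ : (Fin d → ℝ) × ℝ) (T : ℕ) (f : Fin A.k → ℝ) : ℝ :=
  ∫ h, ∑ t, f (h t).1 ∂(A.historyLaw alg θ T)

theorem integrable_sum_action {T : ℕ} (μ : Measure (Fin T → Fin A.k × ℝ)) [IsFiniteMeasure μ]
    (f : Fin A.k → ℝ) : Integrable (fun h => ∑ t, f (h t).1) μ := by
  refine integrable_finsetSum _ fun t _ => ?_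
  have hm : Measurable fun h : Fin T → Fin A.k × ℝ => (h t).1 :=
    measurable_fst.comp (measurable_pi_apply t)
  exact (Integrable.of_finite (f := f) (μ := μ.map fun h => (h t).1)).comp_measurable hm

theorem expSum_mono (alg : BanditAlg A.k) (θ : (Fin d → ℝ) × ℝ) (T : ℕ) {f g : Fin A.k → ℝ}
    (h : ∀ i, f i ≤ g i) : A.expSum alg θ T f ≤ A.expSum alg θ T g :=
  integral_mono (A.integrable_sum_action _ f) (A.integrable_sum_action _ g) fun _ =>
    Finset.sum_le_sum fun _ _ => h _

theorem expSum_const_mul (alg : BanditAlg A.k) (θ : (Fin d → ℝ) × ℝ) (T : ℕ) (c : ℝ)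
    (f : Fin A.k → ℝ) : A.expSum alg θ T (fun i => c * f i) = c * A.expSum alg θ T f := by
  simp only [expSum, ← Finset.mul_sum, integral_const_mul]

theorem expSum_sum {ι : Type*} (S : Finset ι) (alg : BanditAlg A.k) (θ : (Fin d → ℝ) × ℝ) (T : ℕ)
    (f : ι → Fin A.k → ℝ) :
    A.expSum alg θ T (fun i => ∑ j ∈ S, f j i) = ∑ j ∈ S, A.expSum alg θ T (f j) := by
  simp only [expSum]
  rw [← integral_finsetSum _ fun j _ => A.integrable_sum_action _ (f j)]
  exact integral_congr_ae (.of_forall fun h => Finset.sum_comm)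

theorem regret_eq_expSum (alg : BanditAlg A.k) (θ : (Fin d → ℝ) × ℝ) (T : ℕ) :
    A.regret alg θ T = A.expSum alg θ T (A.gap θ.1) := rfl

/-- The Kullback-Leibler divergence between the evaluations of an action under `θ` and `θ'`. -/
def actionDiv (θ θ' : (Fin d → ℝ) × ℝ) (i : Fin A.k) : ℝ :=
  (A.mean θ' i - A.mean θ i) ^ 2 / 2

/-- Divergence decomposition: the part of the log-likelihood that is linear in the noise has mean
zero, and the quadratic part depends on the actions alone. -/
theorem integral_logLik (alg : BanditAlg A.k) (θ θ' : (Fin d → ℝ) × ℝ) (T : ℕ) :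
    Integrable (A.logLik θ θ') (A.historyLaw alg θ T) ∧
      ∫ h, A.logLik θ θ' h ∂(A.historyLaw alg θ T) = -A.expSum alg θ T (A.actionDiv θ θ') := by
  obtain ⟨h1, h2⟩ := A.integral_centered alg θ (fun i => A.mean θ' i - A.mean θ i) T
  have h3 := A.integrable_sum_action (A.historyLaw alg θ T) (A.actionDiv θ θ')
  have h4 : A.logLik θ θ' (t := T) = fun h =>
      (∑ s, (A.mean θ' (h s).1 - A.mean θ (h s).1) * ((h s).2 - A.mean θ (h s).1)) -
        ∑ s, A.actionDiv θ θ' (h s).1 := by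
    funext h
    rw [← Finset.sum_sub_distrib]
    rfl
  rw [h4]
  refine ⟨h1.sub h3, ?_⟩
  rw [integral_sub h1 h3, h2, zero_sub]
  rfl

/-- A pointwise form of the Bretagnolle–Huber inequality. With `l` the log-likelihood ratio and `a`
its mean, integration of the left side gives `exp a - exp a / 2`, so the overlap of the two laws is
at least `exp a / 2`. The tangent line of `exp` and two squares replace Jensen and Cauchy–Schwarz.
-/
theorem min_one_exp_ge (l a : ℝ) :
    Real.exp a * (1 + (l - a) / 2) - (1 + Real.exp l) * (Real.exp a / 4) ≤ min 1 (Real.exp l) := by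
  set q := Real.exp (a / 2) with hq
  set r := Real.exp (l / 2) with hr
  have hqa : Real.exp a = q ^ 2 := by rw [hq, sq, ← Real.exp_add]; ring_nf
  have hrl : Real.exp l = r ^ 2 := by rw [hr, sq, ← Real.exp_add]; ring_nf
  have hq0 : 0 < q := Real.exp_pos _
  have h1 : q * (1 + (l - a) / 2) ≤ r := by
    have := Real.add_one_le_exp ((l - a) / 2)
    calc q * (1 + (l - a) / 2) ≤ q * Real.exp ((l - a) / 2) := by gcongr; linarith
      _ = r := by rw [hq, hr, ← Real.exp_add]; ring_nf
  have h2 : q ^ 2 * (1 + (l - a) / 2) ≤ q * r := by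
    calc q ^ 2 * (1 + (l - a) / 2) = q * (q * (1 + (l - a) / 2)) := by ring
      _ ≤ _ := by gcongr
  rw [hqa, hrl, le_min_iff]
  constructor
  · nlinarith [sq_nonneg (1 - q * r / 2), sq_nonneg q]
  · nlinarith [sq_nonneg (r - q / 2), sq_nonneg (q * r)]

/-- The two-point lower bound: if no action has a small gap under both parameters, the sum of the
regrets is large unless the observations separate the parameters. -/
theorem expSum_add_expSum_ge (alg : BanditAlg A.k) (θ θ' : (Fin d → ℝ) × ℝ) (T : ℕ)
    {g g' : Fin A.k → ℝ} {m : ℝ} (hm : 0 ≤ m) (hg : ∀ i, 0 ≤ g i) (hg' : ∀ i, 0 ≤ g' i)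
    (h : ∀ i, m ≤ g i + g' i) :
    m * T / 2 * Real.exp (-A.expSum alg θ T (A.actionDiv θ θ')) ≤
      A.expSum alg θ T g + A.expSum alg θ' T g' := by
  set a := -A.expSum alg θ T (A.actionDiv θ θ') with ha
  obtain ⟨hl1, hl2⟩ := A.integral_logLik alg θ θ' T
  obtain ⟨he1, he2⟩ := A.integrable_exp_logLik alg θ θ' T
  set μ := A.historyLaw alg θ T with hμ
  have hi1 := A.integrable_sum_action μ g
  have hi2 : Integrable (fun h => Real.exp (A.logLik θ θ' h) * ∑ t, g' (h t).1) μ := by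
    have h1 := A.integrable_sum_action (A.historyLaw alg θ' T) g'
    have hm := A.measurable_logLik θ θ' T
    rw [historyLaw_eq_withDensity A alg θ θ' T, integrable_withDensity_iff_integrable_smul'
      (by fun_prop) (.of_forall fun h => ENNReal.ofReal_lt_top)] at h1
    simpa [ENNReal.toReal_ofReal (Real.exp_nonneg _)] using h1
  have hi5 : Integrable (fun h => (A.logLik θ θ' h - a) / 2) μ :=
    (hl1.sub (integrable_const a)).div_const 2
  have hi3 : Integrable (fun h => Real.exp a * (1 + (A.logLik θ θ' h - a) / 2)) μ :=
    ((integrable_const _).add hi5).const_mul _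
  have hi4 : Integrable (fun h => (1 + Real.exp (A.logLik θ θ' h)) * (Real.exp a / 4)) μ :=
    ((integrable_const _).add he1).mul_const _
  have e3 : ∫ h, Real.exp a * (1 + (A.logLik θ θ' h - a) / 2) ∂μ = Real.exp a := by
    rw [integral_const_mul, integral_add (integrable_const _) hi5, integral_div,
      integral_sub hl1 (integrable_const _), hl2]
    simp [ha]
  have e4 : ∫ h, (1 + Real.exp (A.logLik θ θ' h)) * (Real.exp a / 4) ∂μ = Real.exp a / 2 := by
    rw [integral_mul_const, integral_add (integrable_const _) he1, he2]
    simp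
    ring
  have hT : (0 : ℝ) ≤ m * T := by positivity
  -- The factor `exp a / 2` is the integral of the lower bound on the overlap `min 1 (exp logLik)`;
  -- on this overlap the two pathwise regrets add up to at least `m * T`.
  calc m * T / 2 * Real.exp a
      = ∫ h, m * T * (Real.exp a * (1 + (A.logLik θ θ' h - a) / 2) -
          (1 + Real.exp (A.logLik θ θ' h)) * (Real.exp a / 4)) ∂μ := by
        rw [integral_const_mul, integral_sub hi3 hi4, e3, e4]; ring
    _ ≤ ∫ h, ((∑ t, g (h t).1) + Real.exp (A.logLik θ θ' h) * ∑ t, g' (h t).1) ∂μ := by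
        refine integral_mono ((hi3.sub hi4).const_mul _) (hi1.add hi2) fun p => ?_
        have h1 : m * T ≤ (∑ t, g (p t).1) + ∑ t, g' (p t).1 := by
          rw [← Finset.sum_add_distrib]
          calc m * T = ∑ _t : Fin T, m := by simp [mul_comm]
            _ ≤ _ := Finset.sum_le_sum fun t _ => h _
        have h2 : 0 ≤ ∑ t, g (p t).1 := Finset.sum_nonneg fun t _ => hg _
        have h3 : 0 ≤ ∑ t, g' (p t).1 := Finset.sum_nonneg fun t _ => hg' _
        have h4 := min_le_left 1 (Real.exp (A.logLik θ θ' p))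
        have h5 := min_le_right 1 (Real.exp (A.logLik θ θ' p))
        have h6 : 0 ≤ min 1 (Real.exp (A.logLik θ θ' p)) := le_min zero_le_one (Real.exp_nonneg _)
        dsimp only
        calc _ ≤ m * T * min 1 (Real.exp (A.logLik θ θ' p)) :=
              mul_le_mul_of_nonneg_left (min_one_exp_ge _ _) hT
          _ ≤ ((∑ t, g (p t).1) + ∑ t, g' (p t).1) * min 1 (Real.exp (A.logLik θ θ' p)) :=
              mul_le_mul_of_nonneg_right h1 h6
          _ ≤ _ := by nlinarith
    _ = A.expSum alg θ T g + A.expSum alg θ' T g' := by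
        rw [integral_add hi1 hi2, ← integral_historyLaw_change]
        rfl

theorem gap_eq_of_best {γ : Fin d → ℝ} {b : Fin A.k} (hb : b ∈ A.best γ) (i : Fin A.k) :
    A.gap γ i = A.x b ⬝ᵥ γ - A.x i ⬝ᵥ γ := by
  have : Nonempty (Fin A.k) := ⟨b⟩
  unfold gap
  refine le_antisymm (ciSup_le fun j => ?_) ?_
  · rw [sub_dotProduct]; exact sub_le_sub_right (hb j) _
  · rw [← sub_dotProduct]
    exact le_ciSup (f := fun j => (A.x j - A.x i) ⬝ᵥ γ) (Set.finite_range _).bddAbove b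

theorem gap_nonneg (γ : Fin d → ℝ) (i : Fin A.k) : 0 ≤ A.gap γ i := by
  have := le_ciSup (f := fun j => (A.x j - A.x i) ⬝ᵥ γ) (Set.finite_range _).bddAbove i
  simpa [gap] using this

end ActionSet

/-! ### Logarithmic regret forces logarithmic information. -/

theorem eventually_mul_log_mul_exp_le (K : ℝ) : ∀ᶠ T : ℕ in atTop,
    0 < Real.log T ∧ K * Real.log T * Real.exp (2 / 3 * Real.log T) < T := by
  have h1 := (isLittleO_log_rpow_atTop (r := 1 / 3) (by norm_num)).bound
    (c := 1 / (|K| + 1)) (by positivity)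
  have h2 := (tendsto_natCast_atTop_atTop (R := ℝ)).eventually (h1.and (eventually_gt_atTop 1))
  filter_upwards [h2] with T ⟨hT, hT1⟩
  have hl : 0 < Real.log T := Real.log_pos hT1
  refine ⟨hl, ?_⟩
  have hT0 : (0 : ℝ) < T := by linarith
  rw [Real.norm_of_nonneg hl.le, Real.norm_of_nonneg (by positivity), div_mul_eq_mul_div, one_mul,
    le_div_iff₀ (by positivity)] at hT
  have h3 : Real.exp (2 / 3 * Real.log T) = (T : ℝ) ^ (2 / 3 : ℝ) := by
    rw [Real.rpow_def_of_pos hT0, mul_comm]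
  have h4 : (T : ℝ) ^ (1 / 3 : ℝ) * (T : ℝ) ^ (2 / 3 : ℝ) = T := by
    rw [← Real.rpow_add hT0]; norm_num
  have h5 : K * Real.log T < (T : ℝ) ^ (1 / 3 : ℝ) := by
    nlinarith [le_abs_self K]
  rw [h3]
  calc K * Real.log T * (T : ℝ) ^ (2 / 3 : ℝ)
      < (T : ℝ) ^ (1 / 3 : ℝ) * (T : ℝ) ^ (2 / 3 : ℝ) := by gcongr
    _ = T := h4

/-- A divergence below `2 / 3 * log T` would make the two-point bound of order `T ^ (1 / 3)`, which
exceeds `2 * c * log T`. Any factor below `1` would do asymptotically; `2 / 3` leaves enough room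
for the constants of the theorem. -/
theorem ActionSet.expSum_actionDiv_ge {d : ℕ} (A : ActionSet d) (alg : BanditAlg A.k)
    (θ θ' : (Fin d → ℝ) × ℝ) {T : ℕ} {m c : ℝ} (hm : 0 < m)
    (h : ∀ i, m ≤ A.gap θ.1 i + A.gap θ'.1 i)
    (hT : 4 * c / m * Real.log T * Real.exp (2 / 3 * Real.log T) < T)
    (hR : A.regret alg θ T ≤ c * Real.log T) (hR' : A.regret alg θ' T ≤ c * Real.log T) :
    2 / 3 * Real.log T ≤ A.expSum alg θ T (A.actionDiv θ θ') := by
  by_contra! hlt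
  have h1 := A.expSum_add_expSum_ge alg θ θ' T hm.le (A.gap_nonneg θ.1) (A.gap_nonneg θ'.1) h
  rw [← regret_eq_expSum, ← regret_eq_expSum] at h1
  set L := A.expSum alg θ T (A.actionDiv θ θ')
  have h2 : m * T / 2 * Real.exp (-L) ≤ 2 * c * Real.log T := by linarith
  have h3 : Real.exp (-(2 / 3 * Real.log T)) ≤ Real.exp (-L) := Real.exp_le_exp.2 (by linarith)
  have h4 : m * T / 2 * Real.exp (-(2 / 3 * Real.log T)) ≤ 2 * c * Real.log T :=
    (mul_le_mul_of_nonneg_left h3 (by positivity)).trans h2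
  rw [Real.exp_neg, ← div_eq_mul_inv, div_le_iff₀ (Real.exp_pos _)] at h4
  have h5 : 4 * c / m * Real.log T * Real.exp (2 / 3 * Real.log T) =
      2 * (2 * c * Real.log T * Real.exp (2 / 3 * Real.log T)) / m := by ring
  rw [h5, div_lt_iff₀ hm] at hT
  linarith

/-! ### The hard action set. -/

theorem snoc_dotProduct_snoc {m : ℕ} (v w : Fin m → ℝ) (a b : ℝ) :
    (Fin.snoc v a : Fin (m + 1) → ℝ) ⬝ᵥ (Fin.snoc w b : Fin (m + 1) → ℝ) = v ⬝ᵥ w + a * b := by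
  simp [dotProduct, Fin.sum_univ_castSucc]

/-- The covariates of the hard action set: the canonical basis, and one vector that is far from
optimal when the first two coordinates of the parameter are large. -/
def hardCov (n : ℕ) (s : ℝ) : Fin (n + 3) → (Fin (n + 2) → ℝ) :=
  Fin.snoc (α := fun _ => Fin (n + 2) → ℝ) (fun i => Pi.single i 1)
    (Pi.single 0 (-(1 / s)) + Pi.single 1 (-(1 - 1 / s)))

/-- The groups of the hard action set: only the second action is in the group `-1`. -/
def hardGroup (n : ℕ) : Fin (n + 3) → ℝ :=
  Fin.snoc (α := fun _ => ℝ) (fun i => if i = 1 then -1 else 1) 1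

theorem hardCov_castSucc (n : ℕ) (s : ℝ) (i : Fin (n + 2)) :
    hardCov n s i.castSucc = Pi.single i 1 := by simp [hardCov]

theorem hardCov_last (n : ℕ) (s : ℝ) :
    hardCov n s (Fin.last _) = Pi.single 0 (-(1 / s)) + Pi.single 1 (-(1 - 1 / s)) := by
  simp [hardCov]

theorem hardGroup_castSucc (n : ℕ) (i : Fin (n + 2)) :
    hardGroup n i.castSucc = if i = 1 then -1 else 1 := by simp [hardGroup]

theorem hardGroup_last (n : ℕ) : hardGroup n (Fin.last _) = 1 := by simp [hardGroup]

theorem hardCov_injective (n : ℕ) {s : ℝ} (hs : 1 ≤ s) : Function.Injective (hardCov n s) := by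
  have hs' : 1 / s ≤ 1 := by rw [div_le_one (by linarith)]; exact hs
  have hs0 : 0 ≤ 1 / s := by positivity
  have key (i : Fin (n + 2)) : hardCov n s i.castSucc ≠ hardCov n s (Fin.last _) := by
    intro h
    have h1 := congrFun h i
    rw [hardCov_castSucc, hardCov_last] at h1
    simp only [Pi.single_eq_same, Pi.add_apply, Pi.single_apply] at h1
    split_ifs at h1 <;> linarith
  intro i j
  refine Fin.lastCases ?_ (fun i => ?_) i <;> refine Fin.lastCases ?_ (fun j => ?_) j
  · exact fun _ => rfl
  · exact fun h => (key j h.symm).elim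
  · exact fun h => (key i h).elim
  · intro h
    rw [hardCov_castSucc, hardCov_castSucc] at h
    have h1 := congrFun h i
    by_contra hij
    rw [Pi.single_eq_same, Pi.single_eq_of_ne (fun e => hij (by rw [e]))] at h1
    exact one_ne_zero h1

/-- The coefficients are nonnegative and sum to `s`. This expresses the bias direction through three
actions, which yields both the spanning property and the design of cost at most `s ^ 2`. -/
theorem hardVec_combination (n : ℕ) {s : ℝ} (hs : 1 ≤ s) :
    (1 / 2 : ℝ) • (Fin.snoc (hardCov n s (Fin.castSucc 0)) (hardGroup n (Fin.castSucc 0)) :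
        Fin (n + 3) → ℝ) +
      ((s - 1) / 2) • (Fin.snoc (hardCov n s (Fin.castSucc 1)) (hardGroup n (Fin.castSucc 1)) :
        Fin (n + 3) → ℝ) +
      (s / 2) • (Fin.snoc (hardCov n s (Fin.last _)) (hardGroup n (Fin.last _)) :
        Fin (n + 3) → ℝ) = ActionSet.eLast (n + 2) := by
  have hs0 : s ≠ 0 := by positivity
  rw [hardCov_castSucc, hardCov_castSucc, hardCov_last, hardGroup_castSucc, hardGroup_castSucc,
    hardGroup_last]
  funext j
  refine Fin.lastCases ?_ (fun j => ?_) j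
  · simp [ActionSet.eLast]
    ring
  · simp only [ActionSet.eLast, Pi.add_apply, Pi.smul_apply, Fin.snoc_castSucc, smul_eq_mul,
      Pi.single_apply, Fin.castSucc_ne_last, if_false]
    split_ifs with h1 h2
    · simp [h1] at h2
    · field_simp; ring
    · field_simp; ring
    · ring

/-- The hard action set of dimension `n + 2`. -/
abbrev hardAction (n : ℕ) (s : ℝ) (hs : 1 ≤ s) : ActionSet (n + 2) where
  k := n + 3
  x := hardCov n s
  z := hardGroup n
  z_mem i := by
    refine Fin.lastCases ?_ (fun i => ?_) i
    · exact .inl (hardGroup_last n)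
    · rw [hardGroup_castSucc]; split_ifs <;> simp
  x_injective := hardCov_injective n hs
  exists_pos := ⟨_, hardGroup_last n⟩
  exists_neg := ⟨Fin.castSucc 1, by rw [hardGroup_castSucc, if_pos rfl]⟩
  span_eq_top := by
    set S := Submodule.span ℝ
      (Set.range fun i => (Fin.snoc (hardCov n s i) (hardGroup n i) : Fin (n + 3) → ℝ))
    have hS (i : Fin (n + 3)) :
        (Fin.snoc (hardCov n s i) (hardGroup n i) : Fin (n + 3) → ℝ) ∈ S :=
      Submodule.subset_span ⟨i, rfl⟩
    have hlast : ActionSet.eLast (n + 2) ∈ S := by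
      rw [← hardVec_combination n hs]
      exact S.add_mem (S.add_mem (S.smul_mem _ (hS _)) (S.smul_mem _ (hS _))) (S.smul_mem _ (hS _))
    rw [eq_top_iff, ← (Pi.basisFun ℝ (Fin (n + 3))).span_eq, Submodule.span_le]
    rintro _ ⟨i, rfl⟩
    rw [Pi.basisFun_apply]
    refine Fin.lastCases hlast (fun i => ?_) i
    have h : (Pi.single i.castSucc 1 : Fin (n + 3) → ℝ) =
        (Fin.snoc (hardCov n s i.castSucc) (hardGroup n i.castSucc) : Fin (n + 3) → ℝ) -
          hardGroup n i.castSucc • ActionSet.eLast (n + 2) := by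
      funext j
      refine Fin.lastCases ?_ (fun j => ?_) j
      · simp [ActionSet.eLast]
      · simp [ActionSet.eLast, hardCov_castSucc, Pi.single_apply]
    rw [h]
    exact S.sub_mem (hS _) (S.smul_mem _ hlast)

/-! ### Cost of estimating the bias, and parameters on the hard action set. -/

namespace ActionSet

variable {d : ℕ} (A : ActionSet d)

theorem V_mulVec (μ : Fin A.k → ℝ) (u : Fin (d + 1) → ℝ) :
    A.V μ *ᵥ u = ∑ i, (μ i * (A.vec i ⬝ᵥ u)) • A.vec i := by
  simp only [V, sum_mulVec, smul_mulVec, vecMulVec_mulVec, mul_smul, op_smul_eq_smul]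

theorem V_transpose (μ : Fin A.k → ℝ) : (A.V μ)ᵀ = A.V μ := by
  simp [V, transpose_sum, transpose_smul, transpose_vecMulVec]

/-- By symmetry of `V = V(μ)` and `e = V u`, one has `eᵀ G e = uᵀ V G V u = uᵀ V u = uᵀ e`. The
variance is therefore independent of the generalized inverse `G`, and a solution `u` suffices to
compute it. -/
theorem eLast_genInv_eLast (μ : Fin A.k → ℝ) {u : Fin (d + 1) → ℝ} (hu : A.V μ *ᵥ u = eLast d) :
    eLast d ⬝ᵥ (genInv (A.V μ) *ᵥ eLast d) = u (Fin.last d) := by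
  have h1 : eLast d ⬝ᵥ (genInv (A.V μ) *ᵥ eLast d) =
      u ⬝ᵥ ((A.V μ * genInv (A.V μ) * A.V μ) *ᵥ u) := by
    rw [← mulVec_mulVec, ← mulVec_mulVec, hu, dotProduct_mulVec u, ← mulVec_transpose, V_transpose,
      hu]
  rw [h1, genInv_spec, hu, eLast, dotProduct_single_one]

end ActionSet

section HardAction

variable {n : ℕ} {s : ℝ} (hs : 1 ≤ s)

theorem hardCov_castSucc_dotProduct (i : Fin (n + 2)) (γ : Fin (n + 2) → ℝ) :
    hardCov n s i.castSucc ⬝ᵥ γ = γ i := by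
  rw [hardCov_castSucc, single_one_dotProduct]

theorem hardCov_last_dotProduct (γ : Fin (n + 2) → ℝ) :
    hardCov n s (Fin.last _) ⬝ᵥ γ = -(1 / s) * γ 0 + -(1 - 1 / s) * γ 1 := by
  rw [hardCov_last, add_dotProduct, single_dotProduct, single_dotProduct]

theorem kappa_hardAction_le {Δ : Fin (n + 3) → ℝ}
    (h0 : Δ (Fin.last _) + Δ (Fin.castSucc 0) ≤ 2) (h1 : Δ (Fin.last _) + Δ (Fin.castSucc 1) ≤ 2) :
    (hardAction n s hs).kappa Δ ≤ ((s ^ 2 : ℝ) : EReal) := by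
  have hs0 : 0 < s := by linarith
  -- The design is `s` times the coefficients of `hardVec_combination`. The vector `u` has inner
  -- product `1 / s` with each of the three supporting actions, so `V(μ) u` is exactly that
  -- combination; its last coordinate `1` is the variance.
  set μ : Fin (n + 3) → ℝ := Fin.snoc (α := fun _ => ℝ)
    (Pi.single 0 (s / 2) + Pi.single 1 (s * (s - 1) / 2)) (s ^ 2 / 2) with hμ
  set u : Fin (n + 3) → ℝ := Fin.snoc (α := fun _ => ℝ)
    (Pi.single 0 (1 / s - 1) + Pi.single 1 (1 / s + 1)) 1 with hu
  have hdot (i : Fin (n + 3)) : (hardAction n s hs).vec i ⬝ᵥ u =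
      hardCov n s i ⬝ᵥ (Pi.single 0 (1 / s - 1) + Pi.single 1 (1 / s + 1)) + hardGroup n i * 1 :=
    snoc_dotProduct_snoc _ _ _ _
  have hVu : (hardAction n s hs).V μ *ᵥ u = ActionSet.eLast (n + 2) := by
    rw [ActionSet.V_mulVec, ← hardVec_combination n hs]
    change ∑ i : Fin (n + 3), _ = _
    rw [Fin.sum_univ_castSucc, ← Finset.sum_subset (Finset.subset_univ {0, 1}) (fun i _ hi => ?_),
      Finset.sum_pair (by simp)]
    · refine congrArg₂ _ (congrArg₂ _ (congrArg₂ _ ?_ rfl) (congrArg₂ _ ?_ rfl))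
        (congrArg₂ _ ?_ rfl)
      · rw [hdot, hardCov_castSucc_dotProduct, hardGroup_castSucc]
        simp [hμ]
        field_simp
      · have h2 : μ (Fin.castSucc 1) = s * (s - 1) / 2 := by
          rw [hμ, Fin.snoc_castSucc]; simp
        rw [hdot, hardCov_castSucc_dotProduct, hardGroup_castSucc, h2]
        simp
        field_simp
      · rw [hdot, hardCov_last_dotProduct, hardGroup_last]
        simp [hμ]
        field_simp
        ring
    · have h2 : μ i.castSucc = 0 := by
        simp only [Finset.mem_insert, Finset.mem_singleton, not_or] at hi
        simp [hμ, hi.1, hi.2]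
      rw [h2]
      simp
  have hmem : μ ∈ (hardAction n s hs).biasDesigns := by
    refine ⟨?_, ⟨u, hVu⟩, ?_⟩
    · refine Fin.lastCases (n := n + 2) ?_ fun i => ?_
      · simp [hμ]; positivity
      · have h2 : 0 ≤ s * (s - 1) / 2 := by
          have : 0 ≤ s - 1 := by linarith
          positivity
        simp only [hμ, Fin.snoc_castSucc, Pi.add_apply, Pi.single_apply]
        split_ifs <;> positivity
    · rw [ActionSet.eLast_genInv_eLast _ _ hVu]
      simp [hu]
  refine (iInf₂_le μ hmem).trans (EReal.coe_le_coe_iff.2 ?_)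
  change ∑ i : Fin (n + 3), _ ≤ _
  have hsum : ∑ i : Fin (n + 3), μ i * Δ i = s / 2 * Δ (Fin.castSucc 0) +
      s * (s - 1) / 2 * Δ (Fin.castSucc 1) + s ^ 2 / 2 * Δ (Fin.last _) := by
    rw [Fin.sum_univ_castSucc]
    simp only [hμ, Fin.snoc_castSucc, Fin.snoc_last]
    congr 1
    change _ ⬝ᵥ (fun i : Fin (n + 2) => Δ i.castSucc) = _
    rw [add_dotProduct, single_dotProduct, single_dotProduct]
  rw [hsum]
  -- The weights on `e₀` and `e₁` sum to `s ^ 2 / 2`, the weight of the last action; pairing them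
  -- bounds the cost by `s ^ 2 / 2 * 2`.
  have h2 : s / 2 * Δ (Fin.castSucc 0) ≤ s / 2 * (2 - Δ (Fin.last _)) := by
    gcongr; linarith
  have h3 : s * (s - 1) / 2 * Δ (Fin.castSucc 1) ≤ s * (s - 1) / 2 * (2 - Δ (Fin.last _)) := by
    have : 0 ≤ s - 1 := by linarith
    gcongr; linarith
  nlinarith

theorem mem_best_hardAction {γ : Fin (n + 2) → ℝ} {b : Fin (n + 2)} (h : ∀ j, γ j ≤ γ b)
    (hlast : -(1 / s) * γ 0 + -(1 - 1 / s) * γ 1 ≤ γ b) :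
    b.castSucc ∈ (hardAction n s hs).best γ := by
  refine Fin.lastCases (n := n + 2) ?_ fun i => ?_
  · change hardCov n s _ ⬝ᵥ γ ≤ hardCov n s _ ⬝ᵥ γ
    rwa [hardCov_castSucc_dotProduct, hardCov_last_dotProduct]
  · change hardCov n s _ ⬝ᵥ γ ≤ hardCov n s _ ⬝ᵥ γ
    rw [hardCov_castSucc_dotProduct, hardCov_castSucc_dotProduct]
    exact h i

theorem gap_hardAction {γ : Fin (n + 2) → ℝ} {b : Fin (n + 2)}
    (hb : b.castSucc ∈ (hardAction n s hs).best γ) :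
    (∀ i : Fin (n + 2), (hardAction n s hs).gap γ i.castSucc = γ b - γ i) ∧
      (hardAction n s hs).gap γ (Fin.last (n + 2)) =
        γ b - (-(1 / s) * γ 0 + -(1 - 1 / s) * γ 1) := by
  constructor
  · intro i
    rw [ActionSet.gap_eq_of_best _ hb]
    change hardCov n s _ ⬝ᵥ γ - hardCov n s _ ⬝ᵥ γ = _
    rw [hardCov_castSucc_dotProduct, hardCov_castSucc_dotProduct]
  · rw [ActionSet.gap_eq_of_best _ hb]
    change hardCov n s _ ⬝ᵥ γ - hardCov n s _ ⬝ᵥ γ = _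
    rw [hardCov_castSucc_dotProduct, hardCov_last_dotProduct]

theorem mem_paramsKappa_hardAction {γ : Fin (n + 2) → ℝ} {b : Fin (n + 2)} {Δmin Δneq : ℝ} (ω : ℝ)
    (hΔ : 0 < Δmin) (hle : Δmin ≤ Δneq) (habs : ∀ i, |γ i| ≤ 1)
    (hmin : ∀ j, j ≠ b → γ j + Δmin ≤ γ b)
    (hneq : ∀ j, ¬(j = 1 ↔ b = 1) → γ j + Δneq ≤ γ b)
    (hlast : -(1 / s) * γ 0 + -(1 - 1 / s) * γ 1 + Δneq ≤ γ b)
    (h0 : 2 * γ b - (-(1 / s) * γ 0 + -(1 - 1 / s) * γ 1) - γ 0 ≤ 2)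
    (h1 : 2 * γ b - (-(1 / s) * γ 0 + -(1 - 1 / s) * γ 1) - γ 1 ≤ 2) :
    b.castSucc ∈ (hardAction n s hs).best γ ∧
      (γ, ω) ∈ (hardAction n s hs).paramsKappa Δmin Δneq (s ^ 2) := by
  have hs' : 1 / s ≤ 1 := by rw [div_le_one (by linarith)]; exact hs
  have hs0 : 0 ≤ 1 / s := by positivity
  have hb : b.castSucc ∈ (hardAction n s hs).best γ :=
    mem_best_hardAction hs
      (fun j => by
        by_cases hj : j = b
        · rw [hj]
        · linarith [hmin j hj]) (by linarith)
  obtain ⟨hg1, hg2⟩ := gap_hardAction hs hb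
  have hmin' : ∀ j : Fin (n + 3), j ≠ b.castSucc →
      Δmin ≤ (hardCov n s b.castSucc - hardCov n s j) ⬝ᵥ γ := by
    intro j
    rw [sub_dotProduct, hardCov_castSucc_dotProduct]
    refine Fin.lastCases (fun _ => ?_) (fun j hj => ?_) j
    · rw [hardCov_last_dotProduct]; linarith
    · rw [hardCov_castSucc_dotProduct]
      have := hmin j fun e => hj (by rw [e])
      linarith
  have hneq' : ∀ j : Fin (n + 3), hardGroup n j ≠ hardGroup n b.castSucc →
      Δneq ≤ (hardCov n s b.castSucc - hardCov n s j) ⬝ᵥ γ := by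
    intro j
    rw [sub_dotProduct, hardCov_castSucc_dotProduct]
    refine Fin.lastCases (fun _ => ?_) (fun j hj => ?_) j
    · rw [hardCov_last_dotProduct]; linarith
    · rw [hardCov_castSucc_dotProduct]
      have := hneq j fun e => hj (by simp only [hardGroup_castSucc, e])
      linarith
  have huniq : ∀ i, i ∈ (hardAction n s hs).best γ → i = b.castSucc := by
    intro i hi
    by_contra hne
    have h2 : Δmin ≤ (hardCov n s b.castSucc - hardCov n s i) ⬝ᵥ γ := hmin' i hne
    have h3 : hardCov n s b.castSucc ⬝ᵥ γ ≤ hardCov n s i ⬝ᵥ γ := hi b.castSucc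
    rw [sub_dotProduct] at h2
    linarith
  refine ⟨hb, ⟨?_, ⟨_, hb, huniq⟩, ?_⟩, ?_⟩
  · refine Fin.lastCases (n := n + 2) ?_ fun i => ?_
    · change |hardCov n s _ ⬝ᵥ γ| ≤ 1
      rw [hardCov_last_dotProduct, abs_le]
      have a0 := abs_le.1 (habs 0)
      have a1 := abs_le.1 (habs 1)
      constructor <;> nlinarith
    · change |hardCov n s _ ⬝ᵥ γ| ≤ 1
      rw [hardCov_castSucc_dotProduct]
      exact habs i
  · intro i hi j
    rw [huniq i hi]
    exact ⟨hmin' j, hneq' j⟩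
  · refine kappa_hardAction_le hs ?_ ?_
    · rw [hg2]
      exact (congrArg _ (hg1 0)).trans_le (by linarith)
    · rw [hg2]
      exact (congrArg _ (hg1 1)).trans_le (by linarith)

theorem mean_hardAction (γ : Fin (n + 2) → ℝ) (ω : ℝ) :
    (∀ i : Fin (n + 2), (hardAction n s hs).mean (γ, ω) i.castSucc =
      γ i + (if i = 1 then -1 else 1) * ω) ∧
      (hardAction n s hs).mean (γ, ω) (Fin.last (n + 2)) =
        -(1 / s) * γ 0 + -(1 - 1 / s) * γ 1 + ω := by
  constructor
  · intro i
    change hardCov n s _ ⬝ᵥ γ + hardGroup n _ * ω = _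
    rw [hardCov_castSucc_dotProduct, hardGroup_castSucc]
  · change hardCov n s _ ⬝ᵥ γ + hardGroup n _ * ω = _
    rw [hardCov_last_dotProduct, hardGroup_last, one_mul]

end HardAction

/-! ### The two regret lower bounds. -/

theorem exists_regret_ge_of_bias {n : ℕ} {s : ℝ} (hs : 1 ≤ s) (hs2 : 2 ≤ s ^ 2)
    {Δmin Δneq : ℝ} (hΔ : 0 < Δmin) (hneq : Δneq < 1 / 8) (hle : Δmin ≤ Δneq)
    (alg : BanditAlg (hardAction n s hs).k) {T : ℕ} (hlog : 0 < Real.log T)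
    (hT : 4 * ((s ^ 2 + 2) / (8 * Δneq ^ 2)) / Δmin * Real.log T *
      Real.exp (2 / 3 * Real.log T) < T) :
    ∃ θ ∈ (hardAction n s hs).paramsKappa Δmin Δneq (s ^ 2),
      (s ^ 2 + 2) / (8 * Δneq ^ 2) * Real.log T ≤ (hardAction n s hs).regret alg θ T := by
  have hs0 : 0 < s := by linarith
  have hi1 : 1 / s ≤ 1 := by rw [div_le_one hs0]; exact hs
  have hi0 : 0 < 1 / s := by positivity
  have hn0 : 0 < Δneq := by linarith
  have hp : 1 / s * Δneq ≤ Δneq := mul_le_of_le_one_left hn0.le hi1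
  have hp0 : 0 < 1 / s * Δneq := by positivity
  -- The bias is `0` with `γ` and `Δneq` with `γ'`. The shift by `Δneq` times the group exactly
  -- offsets the change of every coordinate, so all basis actions keep their means.
  set γ : Fin (n + 2) → ℝ := fun i => if i = 0 then 1 / 2 else if i = 1 then 1 / 2 - Δneq else 0
    with hγ
  set γ' : Fin (n + 2) → ℝ :=
    fun i => if i = 0 then 1 / 2 - Δneq else if i = 1 then 1 / 2 else -Δneq with hγ'
  have g0 : γ 0 = 1 / 2 := by simp [hγ]
  have g1 : γ 1 = 1 / 2 - Δneq := by simp [hγ]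
  have g0' : γ' 0 = 1 / 2 - Δneq := by simp [hγ']
  have g1' : γ' 1 = 1 / 2 := by simp [hγ']
  obtain ⟨hb, hmem⟩ := mem_paramsKappa_hardAction hs (γ := γ) (b := 0) 0 hΔ hle
    (fun i => by simp only [hγ]; split_ifs <;> rw [abs_le] <;> constructor <;> linarith)
    (fun j hj => by rw [g0]; simp only [hγ, if_neg hj]; split_ifs <;> linarith)
    (fun j hj => by
      rw [g0]
      have : j = 1 := by simpa using hj
      rw [this, g1]; linarith)
    (by rw [g0, g1]; nlinarith) (by rw [g0, g1]; nlinarith) (by rw [g0, g1]; nlinarith)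
  obtain ⟨hb', hmem'⟩ := mem_paramsKappa_hardAction hs (γ := γ') (b := 1) Δneq hΔ hle
    (fun i => by simp only [hγ']; split_ifs <;> rw [abs_le] <;> constructor <;> linarith)
    (fun j hj => by rw [g1']; simp only [hγ', if_neg hj]; split_ifs <;> linarith)
    (fun j hj => by
      have hj : j ≠ 1 := by simpa using hj
      rw [g1']; simp only [hγ', if_neg hj]; split_ifs <;> linarith)
    (by rw [g0', g1']; nlinarith) (by rw [g0', g1']; nlinarith) (by rw [g0', g1']; nlinarith)
  obtain ⟨hg, hgl⟩ := gap_hardAction hs hb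
  obtain ⟨hg', hgl'⟩ := gap_hardAction hs hb'
  obtain ⟨hm, hml⟩ := mean_hardAction hs γ 0
  obtain ⟨hm', hml'⟩ := mean_hardAction hs γ' Δneq
  by_contra! hcon
  have hkl := (hardAction n s hs).expSum_actionDiv_ge alg (γ, 0) (γ', Δneq) hΔ
    (fun i => ?_) hT (hcon _ hmem).le (hcon _ hmem').le
  swap
  · revert i
    refine Fin.lastCases (n := n + 2) ?_ fun i => ?_
    · rw [hgl, hgl', g0, g1, g0', g1']; nlinarith
    · rw [hg, hg', g0, g1']
      by_cases h0 : i = 0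
      · rw [h0, g0, g0']; linarith
      · simp only [hγ, hγ', if_neg h0]
        split_ifs <;> linarith
  have hle2 : (hardAction n s hs).expSum alg (γ, 0) T
      ((hardAction n s hs).actionDiv (γ, 0) (γ', Δneq)) ≤
      16 * Δneq ^ 2 / (7 * s ^ 2) * (hardAction n s hs).regret alg (γ, 0) T := by
    rw [ActionSet.regret_eq_expSum, ← ActionSet.expSum_const_mul]
    refine ActionSet.expSum_mono _ _ _ _ ?_
    refine Fin.lastCases (n := n + 2) ?_ fun i => ?_
    · rw [ActionSet.actionDiv, hml, hml', hgl, g0, g1, g0', g1']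
      -- The last action has divergence `2 * Δneq ^ 2 / s ^ 2` and gap `1 - (1 - 1 / s) * Δneq ≥ 7 /
      -- 8`; the factor `16 / 7` is `2` divided by `7 / 8`.
      have e1 : (-(1 / s) * (1 / 2 - Δneq) + -(1 - 1 / s) * (1 / 2) + Δneq -
          (-(1 / s) * (1 / 2) + -(1 - 1 / s) * (1 / 2 - Δneq) + 0)) ^ 2 / 2 =
          16 * Δneq ^ 2 / (7 * s ^ 2) * (7 / 8) := by
        field_simp; ring
      rw [e1]
      gcongr
      nlinarith
    · have h0 := (hardAction n s hs).gap_nonneg γ i.castSucc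
      have e1 : (hardAction n s hs).actionDiv (γ, 0) (γ', Δneq) i.castSucc = 0 := by
        rw [ActionSet.actionDiv, hm, hm']
        have : γ' i + (if i = 1 then -1 else 1) * Δneq - (γ i + (if i = 1 then -1 else 1) * 0) =
            0 := by
          by_cases h1 : i = 1
          · rw [h1, g1, g1', if_pos rfl]; ring
          · simp only [hγ, hγ', if_neg h1]
            split_ifs <;> ring
        rw [this]
        norm_num
      rw [e1]
      positivity
  have h3 := hcon _ hmem
  have h4 : 16 * Δneq ^ 2 / (7 * s ^ 2) * (hardAction n s hs).regret alg (γ, 0) T <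
      16 * Δneq ^ 2 / (7 * s ^ 2) * ((s ^ 2 + 2) / (8 * Δneq ^ 2) * Real.log T) := by
    gcongr
  have h5 : 16 * Δneq ^ 2 / (7 * s ^ 2) * ((s ^ 2 + 2) / (8 * Δneq ^ 2) * Real.log T) =
      2 * (s ^ 2 + 2) / (7 * s ^ 2) * Real.log T := by
    field_simp
    ring
  -- This is where `s ^ 2 ≥ 2` enters: the left side is then at most `4 / 7`.
  have h6 : 2 * (s ^ 2 + 2) / (7 * s ^ 2) ≤ 2 / 3 := by
    rw [div_le_div_iff₀ (by positivity) (by norm_num)]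
    nlinarith
  have h7 := mul_le_mul_of_nonneg_right h6 hlog.le
  linarith

theorem exists_regret_ge_of_arms {n : ℕ} (hn : 1 ≤ n) {s : ℝ} (hs : 1 ≤ s)
    {Δmin Δneq : ℝ} (hΔ : 0 < Δmin) (hneq : Δneq < 1 / 8) (hle : Δmin ≤ Δneq)
    (alg : BanditAlg (hardAction n s hs).k) {T : ℕ} (hlog : 0 < Real.log T)
    (hT : 4 * ((n + 2) / (10 * Δmin)) / Δmin * Real.log T *
      Real.exp (2 / 3 * Real.log T) < T) :
    ∃ θ ∈ (hardAction n s hs).paramsKappa Δmin Δneq (s ^ 2),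
      (n + 2) / (10 * Δmin) * Real.log T ≤ (hardAction n s hs).regret alg θ T := by
  have hs0 : 0 < s := by linarith
  have hi1 : 1 / s ≤ 1 := by rw [div_le_one hs0]; exact hs
  have hi0 : 0 < 1 / s := by positivity
  have hn0 : 0 < Δneq := by linarith
  have hp : 1 / s * Δneq ≤ Δneq := mul_le_of_le_one_left hn0.le hi1
  have hp0 : 0 < 1 / s * Δneq := by positivity
  set γ : Fin (n + 2) → ℝ :=
    fun i => if i = 0 then 1 / 2 else if i = 1 then 1 / 2 - Δneq else 1 / 2 - Δmin with hγ
  -- Raising arm `b` from `1 / 2 - Δmin` to `1 / 2 + Δmin` makes it best by the margin `Δmin` over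
  -- `e₀`; its mean moves by `2 * Δmin`.
  set γ' : Fin (n + 2) → Fin (n + 2) → ℝ := fun b => Function.update γ b (1 / 2 + Δmin) with hγ'
  have g0 : γ 0 = 1 / 2 := by simp [hγ]
  have g1 : γ 1 = 1 / 2 - Δneq := by simp [hγ]
  have g2 (i : Fin (n + 2)) (h0 : i ≠ 0) (h1 : i ≠ 1) : γ i = 1 / 2 - Δmin := by
    simp [hγ, h0, h1]
  have gb (b : Fin (n + 2)) : γ' b b = 1 / 2 + Δmin := by simp [hγ']
  have gne (b i : Fin (n + 2)) (h : i ≠ b) : γ' b i = γ i := by simp [hγ', h]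
  obtain ⟨hb, hmem⟩ := mem_paramsKappa_hardAction hs (γ := γ) (b := 0) 0 hΔ hle
    (fun i => by simp only [hγ]; split_ifs <;> rw [abs_le] <;> constructor <;> linarith)
    (fun j hj => by rw [g0]; simp only [hγ, if_neg hj]; split_ifs <;> linarith)
    (fun j hj => by
      rw [g0]
      have : j = 1 := by simpa using hj
      rw [this, g1]; linarith)
    (by rw [g0, g1]; nlinarith) (by rw [g0, g1]; nlinarith) (by rw [g0, g1]; nlinarith)
  have hmem' (b : Fin (n + 2)) (hb0 : b ≠ 0) (hb1 : b ≠ 1) :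
      b.castSucc ∈ (hardAction n s hs).best (γ' b) ∧
      (γ' b, 0) ∈ (hardAction n s hs).paramsKappa Δmin Δneq (s ^ 2) := by
    have e0 := gne b 0 hb0.symm
    have e1 := gne b 1 hb1.symm
    refine mem_paramsKappa_hardAction hs (γ := γ' b) (b := b) 0 hΔ hle ?_ ?_ ?_ ?_ ?_ ?_
    · intro i
      by_cases hi : i = b
      · rw [hi, gb, abs_le]; constructor <;> linarith
      · rw [gne b i hi]
        simp only [hγ]; split_ifs <;> rw [abs_le] <;> constructor <;> linarith
    · intro j hj
      rw [gne b j hj, gb]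
      simp only [hγ]; split_ifs <;> linarith
    · intro j hj
      have : j = 1 := by simpa [hb1] using hj
      rw [this, e1, gb, g1]; linarith
    · rw [gb, e0, e1, g0, g1]; nlinarith
    · rw [gb, e0, e1, g0, g1]; nlinarith
    · rw [gb, e0, e1, g0, g1]; nlinarith
  obtain ⟨hg, hgl⟩ := gap_hardAction hs hb
  obtain ⟨hm, hml⟩ := mean_hardAction hs γ 0
  set S : Finset (Fin (n + 2)) := {0, 1}ᶜ with hS
  have hcard : S.card = n := by
    rw [hS, Finset.card_compl, Finset.card_pair (by simp)]
    simp
  have hSmem (b : Fin (n + 2)) : b ∈ S ↔ b ≠ 0 ∧ b ≠ 1 := by simp [hS]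
  by_contra! hcon
  have hkl (b : Fin (n + 2)) (hbS : b ∈ S) :
      2 / 3 * Real.log T ≤ (hardAction n s hs).expSum alg (γ, 0) T
        ((hardAction n s hs).actionDiv (γ, 0) (γ' b, 0)) := by
    obtain ⟨hb0, hb1⟩ := (hSmem b).1 hbS
    obtain ⟨hb', hm'⟩ := hmem' b hb0 hb1
    obtain ⟨hg', hgl'⟩ := gap_hardAction hs hb'
    refine (hardAction n s hs).expSum_actionDiv_ge alg (γ, 0) (γ' b, 0) hΔ
      ?_ hT (hcon _ hmem).le (hcon _ hm').le
    refine Fin.lastCases (n := n + 2) ?_ fun i => ?_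
    · rw [hgl, hgl', gb, gne b 0 hb0.symm, gne b 1 hb1.symm, g0, g1]; nlinarith
    · rw [hg, hg', gb, g0]
      by_cases hi : i = b
      · rw [hi, g2 b hb0 hb1, gb]; linarith
      · rw [gne b i hi]
        simp only [hγ]; split_ifs <;> linarith
  -- The alternatives are informed by disjoint actions: a play of arm `b` contributes `2 * Δmin ^ 2`
  -- to the alternative `b` alone, which is `2 * Δmin` times its gap. One regret thus pays for the
  -- sum of all divergences.
  have hle2 : (hardAction n s hs).expSum alg (γ, 0) T
      (fun i => ∑ b ∈ S, (hardAction n s hs).actionDiv (γ, 0) (γ' b, 0) i) ≤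
      2 * Δmin * (hardAction n s hs).regret alg (γ, 0) T := by
    rw [ActionSet.regret_eq_expSum, ← ActionSet.expSum_const_mul]
    refine ActionSet.expSum_mono _ _ _ _ ?_
    refine Fin.lastCases (n := n + 2) ?_ fun i => ?_
    · rw [Finset.sum_eq_zero]
      · have h0 := (hardAction n s hs).gap_nonneg γ (Fin.last (n + 2))
        positivity
      · intro b hbS
        obtain ⟨hb0, hb1⟩ := (hSmem b).1 hbS
        rw [ActionSet.actionDiv, hml, (mean_hardAction hs (γ' b) 0).2, gne b 0 hb0.symm,
          gne b 1 hb1.symm]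
        ring
    · have hz (b : Fin (n + 2)) (hib : i ≠ b) :
          (hardAction n s hs).actionDiv (γ, 0) (γ' b, 0) i.castSucc = 0 := by
        rw [ActionSet.actionDiv, hm, (mean_hardAction hs (γ' b) 0).1, gne b i hib]
        ring
      by_cases hi : i ∈ S
      · obtain ⟨hi0, hi1⟩ := (hSmem i).1 hi
        rw [Finset.sum_eq_single_of_mem i hi fun b _ hbi => hz b hbi.symm, ActionSet.actionDiv, hm,
          (mean_hardAction hs (γ' i) 0).1, gb, hg, g0, g2 i hi0 hi1]
        nlinarith
      · rw [Finset.sum_eq_zero fun b hbS => hz b fun e => hi (e ▸ hbS)]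
        have h0 := (hardAction n s hs).gap_nonneg γ i.castSucc
        positivity
  rw [ActionSet.expSum_sum] at hle2
  have h1 := Finset.card_nsmul_le_sum S _ _ hkl
  rw [hcard, nsmul_eq_mul] at h1
  have h3 := hcon _ hmem
  have h4 : 2 * Δmin * (hardAction n s hs).regret alg (γ, 0) T <
      2 * Δmin * ((n + 2) / (10 * Δmin) * Real.log T) := by
    gcongr
  have h5 : 2 * Δmin * ((n + 2) / (10 * Δmin) * Real.log T) = (n + 2) / 5 * Real.log T := by
    field_simp
    ring
  -- The contradiction needs `(n + 2) / 5 ≤ 2 * n / 3`, which follows from `n + 2 ≤ 3 * n`.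
  have hn' : (1 : ℝ) ≤ n := by exact_mod_cast hn
  nlinarith

theorem ActionSet.le_iSup_regret {d : ℕ} (A : ActionSet d) (alg : BanditAlg A.k) {T : ℕ}
    (hlog : 0 < Real.log T) {c : ℝ} {S : Set ((Fin d → ℝ) × ℝ)}
    (h : ∃ θ ∈ S, c * Real.log T ≤ A.regret alg θ T) :
    (c : EReal) ≤ ⨆ θ ∈ S, ((A.regret alg θ T / Real.log T : ℝ) : EReal) := by
  obtain ⟨θ, hθ, h⟩ := h
  exact le_iSup₂_of_le θ hθ (EReal.coe_le_coe_iff.2 ((le_div_iff₀ hlog).2 h))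

end

theorem theorem4 (κ : ℝ) (hκ : 2 ≤ κ) (d : ℕ) (hd : 4 ≤ d) :
    ∃ A : ActionSet d, ∀ Δmin Δneq : ℝ,
      Δmin ∈ Set.Ioo (0 : ℝ) (1 / 8) → Δneq ∈ Set.Ioo (0 : ℝ) (1 / 8) → Δmin ≤ Δneq →
      -- the algorithm may be tuned to the horizon `T`
      ∀ alg : ℕ → BanditAlg A.k,
        ((max ((d : ℝ) / (10 * Δmin)) ((κ + 2) / (8 * Δneq ^ 2)) : ℝ) : EReal) ≤
          liminf (fun T : ℕ => ⨆ θ ∈ A.paramsKappa Δmin Δneq κ,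
            ((A.regret (alg T) θ T / Real.log T : ℝ) : EReal)) atTop := by
  obtain ⟨n, rfl⟩ : ∃ n, d = n + 2 := ⟨d - 2, by omega⟩
  obtain ⟨s, hs, rfl⟩ : ∃ s : ℝ, 1 ≤ s ∧ s ^ 2 = κ :=
    ⟨√κ, Real.one_le_sqrt.2 (by linarith), Real.sq_sqrt (by linarith)⟩
  refine ⟨hardAction n s hs, fun Δmin Δneq hmin hneq hle alg => ?_⟩
  refine le_liminf_of_le (by isBoundedDefault) ?_
  filter_upwards [eventually_mul_log_mul_exp_le (4 * ((n + 2) / (10 * Δmin)) / Δmin),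
    eventually_mul_log_mul_exp_le (4 * ((s ^ 2 + 2) / (8 * Δneq ^ 2)) / Δmin)] with T h1 h2
  rcases max_choice (((n + 2 : ℕ) : ℝ) / (10 * Δmin)) ((s ^ 2 + 2) / (8 * Δneq ^ 2)) with h | h
  · rw [h]
    refine ActionSet.le_iSup_regret _ _ h1.1 ?_
    push_cast
    exact exists_regret_ge_of_arms (by omega) hs hmin.1 hneq.2 hle _ h1.1 h1.2
  · rw [h]
    refine ActionSet.le_iSup_regret _ _ h2.1 ?_
    exact exists_regret_ge_of_bias hs hκ hmin.1 hneq.2 hle _ h2.1 h2.2
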